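/- Let $K$ be a field and let $k, d, r, s$ be positive integers with $r \le d$. Put $n = kd + r$ and $S = K[x_1,\dots,x_n]$ with its standard grading, and let $$I_{n,d} = (x_1x_2\cdots x_d,\ x_2x_3\cdots x_{d+1},\ \dots,\ x_nx_1\cdots x_{d-1}) \subset S$$ be the $d$-path ideal of the $n$-cycle (generated by the $n$ products of $d$ cyclically consecutive variables, indices modulo $n$). Then $$e_0(S/I_{n,d}^s) = \left(d\binom{k+d-r}{k} - \binom{k+d-r}{k+1}\right)\binom{k+s}{s-1}.$$ Here, for a homogeneous ideal $J$ with $D = \dim(S/J) \ge 1$, the multiplicity $e_0(S/J)$ is the integer $e_0$ in the expansion $$\dim_K (S/J)_a = \sum_{i=0}^{D-1} (-1)^i e_i \binom{a + D-1-i}{D-1-i}, \qquad e_i \in \mathbb{Z},$$ valid for all sufficiently large $a$; if $\dim(S/J) = 0$ (which happens above only for $d = 1$), then $e_0(S/J) = \dim_K (S/J)$. -/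

import Mathlib

open scoped Polynomial

/-- The `d`-path ideal of the `n`-cycle in `K[x_0, …, x_{n-1}]`: it is generated by the `n` products
`x_i x_{i+1} ⋯ x_{i+d-1}`, `i = 0, …, n - 1`, the indices being read modulo `n`. -/
noncomputable def cyclePathIdeal (K : Type*) [Field K] (n d : ℕ) : Ideal (MvPolynomial (Fin n) K) :=
  Ideal.span (Set.range fun i : Fin n =>
    ∏ j ∈ Finset.range d, MvPolynomial.X (⟨(i.val + j) % n, Nat.mod_lt _ i.pos⟩ : Fin n))

/-- The Hilbert function `a ↦ dim_K (S/I)_a` of `S/I`, where `S = K[x_0, …, x_{n-1}]` has the standard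
grading: `(S/I)_a` is the image in `S/I` of the space of homogeneous polynomials of degree `a`. -/
noncomputable def hilbertFunction {K : Type*} [Field K] {n : ℕ}
    (I : Ideal (MvPolynomial (Fin n) K)) (a : ℕ) : ℕ :=
  Module.finrank K
    ((MvPolynomial.homogeneousSubmodule (Fin n) K a).map (Ideal.Quotient.mkₐ K I).toLinearMap)

/-- The integers `e 0, …, e (D - 1)` are the Hilbert coefficients of `S/I` (with `D = dim S/I`): for all
large `a`, `dim_K (S/I)_a = ∑_{i=0}^{D-1} (-1)^i e_i * binom (a + (D - 1) - i) ((D - 1) - i)`. -/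
def IsHilbertCoefficients {K : Type*} [Field K] {n : ℕ}
    (I : Ideal (MvPolynomial (Fin n) K)) (D : ℕ) (e : ℕ → ℤ) : Prop :=
  ∀ᶠ a : ℕ in Filter.atTop, (hilbertFunction I a : ℤ) =
    ∑ i ∈ Finset.range D, (-1) ^ i * e i * ((a + (D - 1 - i)).choose (D - 1 - i) : ℤ)

/-- `e_0(S/I) = m`. If `S/I` has positive Krull dimension, then `m` is the first Hilbert coefficient;
if it has dimension zero, then `m` is its length, that is `dim_K S/I`. -/
def HasMultiplicity {K : Type*} [Field K] {n : ℕ}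
    (I : Ideal (MvPolynomial (Fin n) K)) (m : ℤ) : Prop :=
  (ringKrullDim (MvPolynomial (Fin n) K ⧸ I) = 0 ∧
    Module.Finite K (MvPolynomial (Fin n) K ⧸ I) ∧
    (Module.finrank K (MvPolynomial (Fin n) K ⧸ I) : ℤ) = m) ∨
  (∃ D : ℕ, 0 < D ∧ ringKrullDim (MvPolynomial (Fin n) K ⧸ I) = D ∧
    ∃ e : ℕ → ℤ, IsHilbertCoefficients I D e ∧ e 0 = m)

/-- The multiplicity is well defined: it takes at most one value. -/
theorem HasMultiplicity.unique {K : Type*} [Field K] {n : ℕ}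
    {I : Ideal (MvPolynomial (Fin n) K)} {m m' : ℤ}
    (h : HasMultiplicity I m) (h' : HasMultiplicity I m') : m = m' := by
  have key : ∀ D : ℕ, 0 < D → ∀ e : ℕ → ℤ, ∃ P : ℚ[X],
      (∀ a : ℕ, P.eval (a : ℚ) =
        ((∑ i ∈ Finset.range D, (-1) ^ i * e i * ((a + (D - 1 - i)).choose (D - 1 - i) : ℤ) : ℤ) : ℚ)) ∧
      P.coeff (D - 1) = e 0 * ((D - 1).factorial : ℚ)⁻¹ := by
    intro D hD e
    refine ⟨∑ i ∈ Finset.range D,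
      Polynomial.C ((-1) ^ i * (e i : ℚ)) * Polynomial.preHilbertPoly ℚ (D - 1 - i) 0, ?_, ?_⟩
    · intro a
      rw [Polynomial.eval_finsetSum]
      push_cast
      refine Finset.sum_congr rfl fun i _ => ?_
      rw [Polynomial.eval_mul, Polynomial.eval_C,
        Polynomial.preHilbertPoly_eq_choose_sub_add ℚ (D - 1 - i) (Nat.zero_le a)]
      simp
    · rw [Polynomial.finsetSum_coeff, Finset.sum_eq_single 0]
      · simp [Polynomial.coeff_preHilbertPoly_self]
      · intro i hi hi0
        rw [Polynomial.coeff_C_mul, Polynomial.coeff_eq_zero_of_natDegree_lt, mul_zero]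
        rw [Polynomial.natDegree_preHilbertPoly]
        have := Finset.mem_range.1 hi
        omega
      · intro h0
        exact absurd (Finset.mem_range.2 hD) h0
  rcases h with ⟨h0, _, hm⟩ | ⟨D, hD, hdim, e, he, hm⟩ <;>
    rcases h' with ⟨h0', _, hm'⟩ | ⟨D', hD', hdim', e', he', hm'⟩
  · rw [← hm, ← hm']
  · rw [h0] at hdim'
    have : 0 = D' := by exact_mod_cast hdim'
    omega
  · rw [h0'] at hdim
    have : 0 = D := by exact_mod_cast hdim
    omega
  · have hDD : D = D' := by
      rw [hdim] at hdim'
      exact_mod_cast hdim'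
    subst hDD
    obtain ⟨P, hP, hPc⟩ := key D hD e
    obtain ⟨P', hP', hPc'⟩ := key D hD e'
    have hPP : P = P' := by
      obtain ⟨N, hN⟩ := Filter.eventually_atTop.1 (he.and he')
      refine Polynomial.eq_of_infinite_eval_eq P P' ?_
      refine Set.Infinite.mono (s := (fun a : ℕ => (a : ℚ)) '' Set.Ici N) ?_
        ((Set.Ici_infinite N).image Nat.cast_injective.injOn)
      rintro _ ⟨a, ha, rfl⟩
      obtain ⟨h1, h2⟩ := hN a ha
      simp only [Set.mem_ofPred_eq]
      rw [hP, hP', ← h1, ← h2]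
    rw [hPP, hPc'] at hPc
    have hf : ((D - 1).factorial : ℚ)⁻¹ ≠ 0 := by positivity
    have := mul_right_cancel₀ hf hPc
    rw [← hm, ← hm']
    exact_mod_cast this.symm

/-!
The `d`-path ideal of the cycle is the edge ideal `I` of the hypergraph whose edges are the arcs of `d`
consecutive vertices. The multiplicity of `S/I^s` is computed for an arbitrary edge ideal, by counting
monomials, and the least transversals (vertex covers) of the arcs are then counted.

Let `h` be the least size of a transversal. The power `I^s` is spanned by monomials, and its generators
have all exponents at most `s`, so whether `x^u` lies in `I^s` depends only on the truncation `min u s`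
(`mem_powExponents_iff_truncation`). The monomials outside `I^s` therefore form a disjoint union of
orthants `v + ℕ^Z`, one for each `v ≤ s` with `x^v ∉ I^s`, where `Z` is the set of vertices at which
`v` equals `s`; the Hilbert function of `S/I^s` is the sum of the Hilbert functions of the orthants
(`hilbertFunction_edgeIdeal_pow`). The complement of `Z` is a transversal, so `Z` has at most `n - h`
elements, and the leading coefficient is the number of those `v` for which the complement of `Z` is a
transversal `C` of size `h`. In such a `C` every element is the only one on some edge, hence `x^v ∉ I^s`
just says that the degree of `v` on `C` is less than `s`, which leaves `(h + s - 1).choose h` choices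
(`card_standardExponents_of_transversal`). A prime ideal contains `I` only if it contains the variables
of some transversal, so `n - h` is also the Krull dimension (`ringKrullDim_quotient_edgeIdeal_pow`).
Thus the multiplicity is the number of transversals of size `h` times `(h + s - 1).choose h`
(`hasMultiplicity_edgeIdeal_pow`), in dimension zero as well.

For `n = k * d + r` with `1 ≤ r ≤ d` the least size is `k + 1`. A transversal through `0` is a way of
cutting the cycle into `k + 1` gaps of length at most `d`, that is, of distributing the slack `d - r`
among them; there are `(k + d - r).choose k` such ways (`card_intervalTransversals`). Rotating and
counting pairs of a transversal and an element of it gives the total (`card_cycleTransversals`).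
-/

/-! ### Transversals of the subintervals of an interval -/

/-- The `j`-element subsets of `{0, …, L - 1}` that meet every interval of `d` consecutive elements
of `{0, …, L - 1}`. -/
def intervalTransversals (d L j : ℕ) : Finset (Finset ℕ) :=
  {C ∈ (Finset.range L).powersetCard j | ∀ i < L, i + d ≤ L → ∃ c ∈ C, i ≤ c ∧ c < i + d}

theorem mem_intervalTransversals {d L j : ℕ} {C : Finset ℕ} (hd : 0 < d) :
    C ∈ intervalTransversals d L j ↔
      (∀ c ∈ C, c < L) ∧ C.card = j ∧ ∀ i, i + d ≤ L → ∃ c ∈ C, i ≤ c ∧ c < i + d := by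
  simp only [intervalTransversals, Finset.mem_filter, Finset.mem_powersetCard, and_assoc,
    Finset.subset_iff, Finset.mem_range]
  refine and_congr_right fun _ => and_congr_right fun _ => ?_
  exact ⟨fun h i hi => h i (by omega) hi, fun h i _ hi => h i hi⟩

/-- Splitting a transversal as its largest element `m` and the rest, a transversal of
`{0, …, m - 1}`. -/
theorem card_intervalTransversals_succ {d : ℕ} (hd : 0 < d) (L j : ℕ) :
    (intervalTransversals d L (j + 1)).card =
      ∑ m ∈ Finset.Ico (L - d) L, (intervalTransversals d m j).card := by
  rw [← Finset.card_sigma]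
  symm
  refine Finset.card_bij' (fun x _ => insert x.1 x.2)
    (fun C _ => ⟨C.sup id, C.erase (C.sup id)⟩) ?_ ?_ ?_ ?_
  · rintro ⟨m, C⟩ h
    simp only [Finset.mem_sigma, Finset.mem_Ico, mem_intervalTransversals hd] at h ⊢
    obtain ⟨⟨hm1, hm2⟩, hC1, hC2, hC3⟩ := h
    have hmC : m ∉ C := fun h => lt_irrefl _ (hC1 m h)
    refine ⟨?_, by rw [Finset.card_insert_of_notMem hmC, hC2], fun i hi => ?_⟩
    · intro c hc
      rcases Finset.mem_insert.1 hc with rfl | hc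
      · exact hm2
      · exact (hC1 c hc).trans hm2
    · by_cases him : i + d ≤ m
      · obtain ⟨c, hc, h⟩ := hC3 i him
        exact ⟨c, Finset.mem_insert_of_mem hc, h⟩
      · exact ⟨m, Finset.mem_insert_self _ _, by omega, by omega⟩
  · intro C h
    simp only [Finset.mem_sigma, Finset.mem_Ico, mem_intervalTransversals hd] at h ⊢
    obtain ⟨hC1, hC2, hC3⟩ := h
    have hne : C.Nonempty := by rw [← Finset.card_pos, hC2]; omega
    have hmem : C.sup id ∈ C := by
      obtain ⟨x, hx, hx'⟩ := Finset.exists_mem_eq_sup C hne id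
      rw [hx']; exact hx
    have hle : ∀ c ∈ C, c ≤ C.sup id := fun c hc => Finset.le_sup (f := id) hc
    refine ⟨⟨?_, hC1 _ hmem⟩, ?_, by rw [Finset.card_erase_of_mem hmem, hC2]; rfl, ?_⟩
    · by_contra hlt
      obtain ⟨c, hc, h1, h2⟩ := hC3 (L - d) (by omega)
      have := hle c hc
      omega
    · intro c hc
      rw [Finset.mem_erase] at hc
      exact lt_of_le_of_ne (hle c hc.2) hc.1
    · intro i hi
      obtain ⟨c, hc, h1, h2⟩ := hC3 i (hi.trans (hC1 _ hmem).le)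
      exact ⟨c, Finset.mem_erase.2 ⟨by omega, hc⟩, h1, h2⟩
  · rintro ⟨m, C⟩ h
    simp only [Finset.mem_sigma, mem_intervalTransversals hd] at h
    have hmC : m ∉ C := fun h' => lt_irrefl _ (h.2.1 m h')
    have hs : (insert m C).sup id = m := by
      rw [Finset.sup_insert, id, sup_eq_left]
      exact Finset.sup_le fun c hc => (h.2.1 c hc).le
    rw [hs, Finset.erase_insert hmC]
  · intro C h
    simp only [mem_intervalTransversals hd] at h
    have hne : C.Nonempty := by rw [← Finset.card_pos, h.2.1]; omega
    obtain ⟨x, hx, hx'⟩ := Finset.exists_mem_eq_sup C hne id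
    exact Finset.insert_erase (by rw [hx']; exact hx)

theorem card_intervalTransversals_zero {d : ℕ} (hd : 0 < d) (L : ℕ) :
    (intervalTransversals d L 0).card = if L < d then 1 else 0 := by
  split_ifs with h
  · rw [Finset.card_eq_one]
    refine ⟨∅, ?_⟩
    ext C
    rw [mem_intervalTransversals hd, Finset.card_eq_zero, Finset.mem_singleton]
    refine ⟨fun h => h.2.1, ?_⟩
    rintro rfl
    exact ⟨by simp, rfl, fun i hi => by omega⟩
  · rw [Finset.card_eq_zero, Finset.eq_empty_iff_forall_notMem]
    intro C hC
    rw [mem_intervalTransversals hd, Finset.card_eq_zero] at hC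
    obtain ⟨c, hc, -⟩ := hC.2.2 0 (by omega)
    simp [hC.2.1] at hc

/-- There are not enough elements to reach every interval when `L` is large. -/
theorem card_intervalTransversals_eq_zero {d : ℕ} (hd : 0 < d) (j L : ℕ) (h : (j + 1) * d ≤ L) :
    (intervalTransversals d L j).card = 0 := by
  induction j generalizing L with
  | zero => rw [card_intervalTransversals_zero hd, if_neg (by omega)]
  | succ j ih =>
    rw [card_intervalTransversals_succ hd]
    refine Finset.sum_eq_zero fun m hm => ih m ?_
    rw [Finset.mem_Ico] at hm
    rw [add_mul, one_mul] at h
    omega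

/-- The slack `t` is shared out among the `j + 1` gaps of the transversal. As `t < d`, no gap can become
empty, so the distributions are counted without further restriction. -/
theorem card_intervalTransversals {d : ℕ} (j L t : ℕ) (ht : t < d)
    (h : L + 1 + t = (j + 1) * d) :
    (intervalTransversals d L j).card = (j + t).choose j := by
  have hd : 0 < d := by omega
  induction j generalizing L t with
  | zero =>
    rw [card_intervalTransversals_zero hd, if_pos (by omega)]
    simp
  | succ j ih =>
    rw [add_mul, one_mul] at h
    have hjd : d ≤ (j + 1) * d := Nat.le_mul_of_pos_left d (by omega)
    -- For a largest element `L - d + q` the slack is `t - q` if `q ≤ t`, and otherwise there is no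
    -- transversal.
    rw [card_intervalTransversals_succ hd, Finset.sum_Ico_eq_sum_range,
      show L - (L - d) = (t + 1) + (d - (t + 1)) by omega, Finset.sum_range_add,
      Finset.sum_eq_zero (s := Finset.range (d - (t + 1))), add_zero]
    · rw [Finset.sum_congr rfl (g := fun q => (t - q + j).choose j)]
      · have := Finset.sum_range_reflect (fun q => (q + j).choose j) (t + 1)
        simp only [Nat.add_sub_cancel] at this
        rw [this, Nat.sum_range_add_choose]
        congr 1
        omega
      · intro q hq
        rw [Finset.mem_range] at hq
        rw [ih (L - d + q) (t - q) (by omega) (by omega), add_comm]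
    · intro q hq
      rw [Finset.mem_range] at hq
      exact card_intervalTransversals_eq_zero hd _ _ (by omega)

/-! ### Transversals of the arcs of a cycle -/

/-- A set of vertices is a transversal (or vertex cover) of the family of edges `E` if it meets every
edge. -/
def IsTransversal {σ ι : Type*} (E : ι → Finset σ) (C : Finset σ) : Prop :=
  ∀ i, ∃ c ∈ C, c ∈ E i

/-- The arc `{i, i + 1, …, i + d - 1}` of the cycle `Fin n`. -/
def cycleArc (n d : ℕ) (i : Fin n) : Finset (Fin n) :=
  {x | (x - i).val < d}

theorem isTransversal_cycleArc_iff {n d : ℕ} {C : Finset (Fin n)} :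
    IsTransversal (cycleArc n d) C ↔ ∀ i, ∃ c ∈ C, (c - i).val < d := by
  simp [IsTransversal, cycleArc]

/-- Each vertex meets only `d` of the arcs. -/
theorem le_card_mul_of_isTransversal {n d : ℕ} {C : Finset (Fin n)}
    (hC : IsTransversal (cycleArc n d) C) : n ≤ C.card * d := by
  rcases Nat.eq_zero_or_pos n with rfl | hn
  · exact Nat.zero_le _
  have : NeZero n := ⟨hn.ne'⟩
  rw [isTransversal_cycleArc_iff] at hC
  have h1 : (Finset.univ : Finset (Fin n)) ⊆
      C.biUnion fun c => (Finset.range d).image fun j => c - Fin.ofNat n j := by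
    intro i _
    obtain ⟨c, hc, h⟩ := hC i
    rw [Finset.mem_biUnion]
    refine ⟨c, hc, Finset.mem_image.2 ⟨(c - i).val, Finset.mem_range.2 h, ?_⟩⟩
    simp
  calc n = (Finset.univ : Finset (Fin n)).card := by simp
    _ ≤ _ := Finset.card_le_card h1
    _ ≤ C.card * d := Finset.card_biUnion_le_card_mul _ _ _ fun c _ =>
        Finset.card_image_le.trans (by simp)

open Classical in
/-- The transversals of the `d`-arcs of the cycle `Fin n` that have `j` elements. -/
noncomputable def cycleTransversals (n d j : ℕ) : Finset (Finset (Fin n)) :=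
  {C | IsTransversal (cycleArc n d) C ∧ C.card = j}

open Classical in
/-- Cutting the cycle at `0`: transversals through `0` are transversals of an interval. -/
theorem card_filter_zero_mem_cycleTransversals {N d j : ℕ} (hd : 0 < d) (hdN : d ≤ N) :
    ((cycleTransversals (N + 1) d (j + 1)).filter (0 ∈ ·)).card =
      (intervalTransversals d N j).card := by
  have hval' : ∀ {c i : Fin (N + 1)}, c < i → (c - i).val = N + 1 + c.val - i.val := by
    intro c i h
    rw [Fin.coe_sub_iff_lt.2 h]
  have hmem : ∀ {C : Finset ℕ}, (∀ c ∈ C, c < N) → ∀ x : Fin (N + 1),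
      x ∈ C.image (fun c => Fin.ofNat (N + 1) (c + 1)) ↔ x ≠ 0 ∧ x.val - 1 ∈ C := by
    intro C hC x
    rw [Finset.mem_image]
    constructor
    · rintro ⟨c, hc, rfl⟩
      have h1 : (Fin.ofNat (N + 1) (c + 1)).val = c + 1 :=
        Nat.mod_eq_of_lt (by have := hC c hc; omega)
      refine ⟨fun h => ?_, by rw [h1]; exact hc⟩
      rw [h] at h1
      simp at h1
    · rintro ⟨hx, h⟩
      have hx' : x.val ≠ 0 := fun h => hx (Fin.ext h)
      refine ⟨_, h, Fin.ext ?_⟩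
      have := x.isLt
      rw [Fin.val_ofNat, Nat.mod_eq_of_lt] <;> omega
  have hmem' : ∀ (D : Finset (Fin (N + 1))) (c : ℕ), c ∈ (D.erase 0).image (fun x => x.val - 1) ↔
      ∃ x ∈ D, x.val = c + 1 := by
    intro D c
    simp only [Finset.mem_image, Finset.mem_erase]
    constructor
    · rintro ⟨x, ⟨hx, hxD⟩, rfl⟩
      have hx' : x.val ≠ 0 := fun h => hx (Fin.ext h)
      exact ⟨x, hxD, by omega⟩
    · rintro ⟨x, hx, h⟩
      refine ⟨x, ⟨?_, hx⟩, by omega⟩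
      rintro rfl
      simp at h
  symm
  refine Finset.card_bij' (fun C _ => insert 0 (C.image fun c => Fin.ofNat (N + 1) (c + 1)))
    (fun D _ => (D.erase 0).image fun x => x.val - 1) ?_ ?_ ?_ ?_
  · intro C hC
    rw [mem_intervalTransversals hd] at hC
    obtain ⟨h1, h2, h3⟩ := hC
    simp only [cycleTransversals, Finset.mem_filter, Finset.mem_univ, true_and,
      Finset.mem_insert_self, and_true]
    constructor
    · rw [isTransversal_cycleArc_iff]
      intro i
      by_cases hi : i = 0
      · exact ⟨0, Finset.mem_insert_self _ _, by simpa [hi] using hd⟩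
      have hi' : i.val ≠ 0 := fun h => hi (Fin.ext h)
      by_cases hiN : i.val - 1 + d ≤ N
      · obtain ⟨c, hc, hc1, hc2⟩ := h3 _ hiN
        have hcN := h1 c hc
        have hle : i ≤ (⟨c + 1, by omega⟩ : Fin (N + 1)) := Fin.le_def.2 (by simp; omega)
        refine ⟨⟨c + 1, by omega⟩, Finset.mem_insert_of_mem ((hmem h1 _).2 ⟨?_, hc⟩), ?_⟩
        · exact fun h => by simpa using congrArg Fin.val h
        · rw [Fin.sub_val_of_le hle]
          simp only
          omega
      · refine ⟨0, Finset.mem_insert_self _ _, ?_⟩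
        rw [hval' (Fin.pos_iff_ne_zero.2 hi)]
        simp only [Fin.val_zero]
        omega
    · rw [Finset.card_insert_of_notMem fun h => ((hmem h1 _).1 h).1 rfl,
        Finset.card_image_of_injOn, h2]
      intro a ha b hb hab
      have ha' := h1 a ha
      have hb' := h1 b hb
      have h := congrArg Fin.val hab
      simp only [Fin.val_ofNat] at h
      rw [Nat.mod_eq_of_lt (by omega), Nat.mod_eq_of_lt (by omega)] at h
      omega
  · intro D hD
    simp only [cycleTransversals, Finset.mem_filter, Finset.mem_univ, true_and,
      isTransversal_cycleArc_iff] at hD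
    obtain ⟨⟨h1, h2⟩, h0⟩ := hD
    rw [mem_intervalTransversals hd]
    refine ⟨?_, ?_, ?_⟩
    · intro c hc
      obtain ⟨x, -, hx⟩ := (hmem' D c).1 hc
      have := x.isLt
      omega
    · rw [Finset.card_image_of_injOn, Finset.card_erase_of_mem h0, h2, Nat.add_sub_cancel]
      intro a ha b hb hab
      have ha' : a.val ≠ 0 := fun h => (Finset.mem_erase.1 ha).1 (Fin.ext h)
      have hb' : b.val ≠ 0 := fun h => (Finset.mem_erase.1 hb).1 (Fin.ext h)
      simp only at hab
      exact Fin.ext (by omega)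
    · intro i hi
      obtain ⟨x, hx, hxd⟩ := h1 ⟨i + 1, by omega⟩
      rcases lt_or_ge x (⟨i + 1, by omega⟩ : Fin (N + 1)) with hlt | hge
      · rw [hval' hlt] at hxd
        simp only at hxd
        omega
      · rw [Fin.sub_val_of_le hge] at hxd
        rw [Fin.le_def] at hge
        simp only at hge hxd
        exact ⟨x.val - 1, (hmem' D _).2 ⟨x, hx, by omega⟩, by omega, by omega⟩
  · intro C hC
    rw [mem_intervalTransversals hd] at hC
    ext c
    rw [hmem']
    constructor
    · rintro ⟨x, hx, hxc⟩
      rcases Finset.mem_insert.1 hx with rfl | hx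
      · simp at hxc
      · have := ((hmem hC.1 x).1 hx).2
        rwa [hxc, Nat.add_sub_cancel] at this
    · intro hc
      have hcN := hC.1 c hc
      refine ⟨⟨c + 1, by omega⟩, Finset.mem_insert_of_mem ((hmem hC.1 _).2 ⟨?_, hc⟩), rfl⟩
      exact fun h => by simpa using congrArg Fin.val h
  · intro D hD
    have h0 := (Finset.mem_filter.1 hD).2
    ext x
    rw [Finset.mem_insert, hmem, hmem']
    · constructor
      · rintro (rfl | ⟨hx, y, hy, hyx⟩)
        · exact h0
        · have hx' : x.val ≠ 0 := fun h => hx (Fin.ext h)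
          rwa [← show y = x from Fin.ext (by omega)]
      · intro hx
        by_cases hx0 : x = 0
        · exact Or.inl hx0
        · have hx' : x.val ≠ 0 := fun h => hx0 (Fin.ext h)
          exact Or.inr ⟨hx0, x, hx, by omega⟩
    · intro c hc
      obtain ⟨y, -, hy⟩ := (hmem' D c).1 hc
      have := y.isLt
      omega

open Classical in
/-- By rotation, every vertex of the cycle lies on equally many transversals. -/
theorem card_filter_mem_cycleTransversals {N d j : ℕ} (x : Fin (N + 1)) :
    ((cycleTransversals (N + 1) d j).filter (x ∈ ·)).card =
      ((cycleTransversals (N + 1) d j).filter (0 ∈ ·)).card := by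
  have key : ∀ (C : Finset (Fin (N + 1))) (y : Fin (N + 1)), C ∈ cycleTransversals (N + 1) d j →
      C.map (addRightEmbedding y) ∈ cycleTransversals (N + 1) d j := by
    intro C y hC
    simp only [cycleTransversals, Finset.mem_filter, Finset.mem_univ, true_and,
      isTransversal_cycleArc_iff, Finset.card_map] at hC ⊢
    refine ⟨fun i => ?_, hC.2⟩
    obtain ⟨c, hc, h⟩ := hC.1 (i - y)
    refine ⟨c + y, Finset.mem_map.2 ⟨c, hc, rfl⟩, ?_⟩
    rwa [show c + y - i = c - (i - y) by abel]
  refine Finset.card_bij' (fun C _ => C.map (addRightEmbedding (-x)))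
    (fun C _ => C.map (addRightEmbedding x)) ?_ ?_ ?_ ?_
  · intro C hC
    rw [Finset.mem_filter] at hC ⊢
    exact ⟨key C _ hC.1, Finset.mem_map.2 ⟨x, hC.2, by simp⟩⟩
  · intro C hC
    rw [Finset.mem_filter] at hC ⊢
    exact ⟨key C _ hC.1, Finset.mem_map.2 ⟨0, hC.2, by simp⟩⟩
  · intro C _
    ext y
    simp
  · intro C _
    ext y
    simp

/-- Double counting of the pairs of a minimum transversal and a vertex on it. -/
theorem succ_mul_card_cycleTransversals {k d r : ℕ} (hk : 1 ≤ k) (hr : 1 ≤ r) (hrd : r ≤ d) :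
    (k + 1) * (cycleTransversals (k * d + r) d (k + 1)).card =
      (k * d + r) * (k + d - r).choose k := by
  classical
  obtain ⟨N, hN⟩ : ∃ N, k * d + r = N + 1 := ⟨k * d + r - 1, by omega⟩
  have hkd : d ≤ k * d := Nat.le_mul_of_pos_left d hk
  rw [hN]
  have h0 : ((cycleTransversals (N + 1) d (k + 1)).filter (0 ∈ ·)).card =
      (k + d - r).choose k := by
    rw [card_filter_zero_mem_cycleTransversals (by omega) (by omega),
      card_intervalTransversals k N (d - r) (by omega), show k + (d - r) = k + d - r by omega]
    rw [add_mul, one_mul]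
    omega
  have := Finset.sum_card_bipartiteAbove_eq_sum_card_bipartiteBelow
    (s := (Finset.univ : Finset (Fin (N + 1)))) (t := cycleTransversals (N + 1) d (k + 1))
    (fun x C => x ∈ C)
  simp only [Finset.bipartiteAbove, Finset.bipartiteBelow, card_filter_mem_cycleTransversals, h0,
    Finset.filter_univ_mem] at this
  rw [Finset.sum_const, Finset.card_univ, Fintype.card_fin, smul_eq_mul,
    Finset.sum_congr rfl (g := fun _ => k + 1), Finset.sum_const, smul_eq_mul] at this
  · rw [this, mul_comm]
  · intro C hC
    exact (Finset.mem_filter.1 hC).2.2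

theorem card_cycleTransversals {k d r : ℕ} (hk : 1 ≤ k) (hr : 1 ≤ r) (hrd : r ≤ d) :
    ((cycleTransversals (k * d + r) d (k + 1)).card : ℤ) =
      (d : ℤ) * ((k + d - r).choose k : ℤ) - ((k + d - r).choose (k + 1) : ℤ) := by
  have h1 := succ_mul_card_cycleTransversals hk hr hrd
  have h2 := Nat.choose_succ_right_eq (k + d - r) k
  rw [show k + d - r - k = d - r by omega] at h2
  zify [hrd] at h1 h2
  have h3 : ((k : ℤ) + 1) ≠ 0 := by positivity
  refine mul_left_cancel₀ h3 ?_
  linear_combination h1 + h2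

/-! ### Exponents of the monomials in a power of an edge ideal -/

/-- The edge ideal of a family of finite sets of variables, generated by the products of the
variables in an edge. -/
noncomputable def edgeIdeal (K : Type*) [Field K] {σ ι : Type*} (E : ι → Finset σ) :
    Ideal (MvPolynomial σ K) :=
  Ideal.span (Set.range fun i => ∏ x ∈ E i, MvPolynomial.X x)

/-- The exponent of the monomial `∏ x ∈ E i, X x`. -/
noncomputable def edgeExponent {σ ι : Type*} (E : ι → Finset σ) (i : ι) : σ →₀ ℕ :=
  ∑ x ∈ E i, Finsupp.single x 1

/-- The exponents of the monomials in the `s`-th power of the edge ideal: those above some sum of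
`s` exponents of edges. -/
def powExponents {σ ι : Type*} (E : ι → Finset σ) : ℕ → Set (σ →₀ ℕ)
  | 0 => Set.univ
  | s + 1 => {v | ∃ i, ∃ u ∈ powExponents E s, u + edgeExponent E i ≤ v}

section

variable {σ ι : Type*} {E : ι → Finset σ}

theorem edgeExponent_apply [DecidableEq σ] (i : ι) (x : σ) :
    edgeExponent E i x = if x ∈ E i then 1 else 0 := by
  simp [edgeExponent, Finsupp.finsetSum_apply, Finsupp.single_apply]

theorem sum_edgeExponent [DecidableEq σ] (i : ι) (C : Finset σ) :
    ∑ x ∈ C, edgeExponent E i x = (C ∩ E i).card := by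
  simp [edgeExponent_apply]

theorem powExponents_mono {s : ℕ} {u v : σ →₀ ℕ} (h : u ≤ v) (hu : u ∈ powExponents E s) :
    v ∈ powExponents E s := by
  cases s with
  | zero => trivial
  | succ s =>
    obtain ⟨i, w, hw, hwu⟩ := hu
    exact ⟨i, w, hw, hwu.trans h⟩

theorem mem_edgeIdeal_pow_iff {K : Type*} [Field K] {s : ℕ} {f : MvPolynomial σ K} :
    f ∈ edgeIdeal K E ^ s ↔ ∀ v ∈ f.support, v ∈ powExponents E s := by
  have hspan : edgeIdeal K E ^ s =
      Ideal.span ((fun v => MvPolynomial.monomial v (1 : K)) '' powExponents E s) := by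
    have h1 : edgeIdeal K E = Ideal.span (Set.range fun i =>
        MvPolynomial.monomial (edgeExponent E i) (1 : K)) := by
      simp only [edgeIdeal, edgeExponent, MvPolynomial.X, MvPolynomial.monomial_sum_one]
    induction s with
    | zero =>
      rw [pow_zero, Ideal.one_eq_top, eq_comm, Ideal.eq_top_iff_one]
      exact Ideal.subset_span ⟨0, trivial, rfl⟩
    | succ s ih =>
      rw [pow_succ, ih, h1, Ideal.span_mul_span']
      apply le_antisymm
      · rw [Ideal.span_le]
        rintro _ ⟨_, ⟨u, hu, rfl⟩, _, ⟨i, rfl⟩, rfl⟩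
        refine Ideal.subset_span ⟨u + edgeExponent E i, ⟨i, u, hu, le_rfl⟩, ?_⟩
        simp
      · rw [Ideal.span_le]
        rintro _ ⟨v, ⟨i, u, hu, huv⟩, rfl⟩
        have : MvPolynomial.monomial v (1 : K) = MvPolynomial.monomial (v - (u + edgeExponent E i)) 1 *
            (MvPolynomial.monomial u 1 * MvPolynomial.monomial (edgeExponent E i) 1) := by
          simp [tsub_add_cancel_of_le huv]
        simp only [SetLike.mem_coe]
        rw [this]
        exact Ideal.mul_mem_left _ _ (Ideal.subset_span
          (Set.mul_mem_mul ⟨u, hu, rfl⟩ ⟨i, rfl⟩))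
  rw [hspan, MvPolynomial.mem_ideal_span_monomial_image]
  refine forall₂_congr fun v _ => ⟨?_, fun h => ⟨v, h, le_rfl⟩⟩
  rintro ⟨u, hu, huv⟩
  exact powExponents_mono huv hu

/-- A generator of the `s`-th power has all exponents at most `s`, so membership only depends on the
exponents truncated at `s`. -/
theorem mem_powExponents_iff_truncation {s : ℕ} {v : σ →₀ ℕ} :
    v.mapRange (min s) (min_eq_right s.zero_le) ∈ powExponents E s ↔ v ∈ powExponents E s := by
  refine ⟨powExponents_mono fun x => by simp, fun h => ?_⟩
  have key : ∀ s (v : σ →₀ ℕ), v ∈ powExponents E s →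
      ∃ u ≤ v, u ∈ powExponents E s ∧ ∀ x, u x ≤ s := by
    intro s
    induction s with
    | zero => exact fun v _ => ⟨0, bot_le, trivial, fun x => le_rfl⟩
    | succ s ih =>
      rintro v ⟨i, u, hu, huv⟩
      obtain ⟨w, hwu, hw, hws⟩ := ih u hu
      refine ⟨w + edgeExponent E i, le_trans (by gcongr) huv, ⟨i, w, hw, le_rfl⟩, fun x => ?_⟩
      classical
      have := hws x
      rw [Finsupp.add_apply, edgeExponent_apply]
      split_ifs <;> omega
  obtain ⟨u, huv, hu, hus⟩ := key s v h
  exact powExponents_mono (fun x => by simpa using ⟨hus x, huv x⟩) hu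

/-- Each edge in a product of `s` edges contributes to the degree in the variables of `C`. -/
theorem le_sum_of_mem_powExponents {C : Finset σ} (hC : IsTransversal E C) {s : ℕ} {v : σ →₀ ℕ}
    (hv : v ∈ powExponents E s) : s ≤ ∑ x ∈ C, v x := by
  classical
  induction s generalizing v with
  | zero => exact Nat.zero_le _
  | succ s ih =>
    obtain ⟨i, u, hu, huv⟩ := hv
    obtain ⟨c, hc, hci⟩ := hC i
    have h1 : 1 ≤ (C ∩ E i).card := Finset.card_pos.2 ⟨c, Finset.mem_inter.2 ⟨hc, hci⟩⟩
    calc s + 1 ≤ ∑ x ∈ C, u x + ∑ x ∈ C, edgeExponent E i x := by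
          rw [sum_edgeExponent]
          exact add_le_add (ih hu) h1
      _ = ∑ x ∈ C, (u + edgeExponent E i) x := by
          rw [← Finset.sum_add_distrib]
          rfl
      _ ≤ _ := Finset.sum_le_sum fun x _ => huv x

theorem mem_powExponents_of_edge {i : ι} {s : ℕ} {v : σ →₀ ℕ} (hv : ∀ x ∈ E i, s ≤ v x) :
    v ∈ powExponents E s := by
  classical
  induction s generalizing v with
  | zero => trivial
  | succ s ih =>
    have hle : edgeExponent E i ≤ v := fun x => by
      rw [edgeExponent_apply]
      split_ifs with h
      · have := hv x h
        omega
      · exact Nat.zero_le _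
    refine ⟨i, v - edgeExponent E i, ih fun x hx => ?_, (tsub_add_cancel_of_le hle).le⟩
    have := hv x hx
    rw [Finsupp.tsub_apply, edgeExponent_apply, if_pos hx]
    omega

/-- If the exponents of a monomial reach `s` on a whole edge, then the `s`-th power of that edge divides
the monomial. -/
theorem isTransversal_of_notMem_powExponents [Fintype σ] [DecidableEq σ] {s : ℕ} {v : σ →₀ ℕ}
    (hv : v ∉ powExponents E s) : IsTransversal E {x | v x < s} := by
  intro i
  by_contra! h
  refine hv (mem_powExponents_of_edge (i := i) fun x hx => ?_)
  by_contra! hlt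
  exact h x (by simpa using hlt) hx

/-- If every element of `C` is the only element of `C` on some edge, then inverting the variables
outside `C` turns the edge ideal into the ideal of the variables in `C`. -/
theorem mem_powExponents_of_private_edges {C : Finset σ}
    (hC : ∀ c ∈ C, ∃ i, c ∈ E i ∧ ∀ x ∈ C, x ∈ E i → x = c) {s : ℕ} {v : σ →₀ ℕ}
    (hv : ∀ x ∉ C, s ≤ v x) (hsum : s ≤ ∑ x ∈ C, v x) : v ∈ powExponents E s := by
  classical
  induction s generalizing v with
  | zero => trivial
  | succ s ih =>
    obtain ⟨c, hc, hvc⟩ : ∃ c ∈ C, v c ≠ 0 := by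
      by_contra! h
      rw [Finset.sum_eq_zero h] at hsum
      omega
    obtain ⟨i, hci, hi⟩ := hC c hc
    have hle : edgeExponent E i ≤ v := fun x => by
      rw [edgeExponent_apply]
      split_ifs with h
      · by_cases hx : x ∈ C
        · rw [hi x hx h]
          omega
        · have := hv x hx
          omega
      · exact Nat.zero_le _
    have heq := tsub_add_cancel_of_le hle
    refine ⟨i, v - edgeExponent E i, ih (fun x hx => ?_) ?_, heq.le⟩
    · have := hv x hx
      rw [Finsupp.tsub_apply, edgeExponent_apply]
      split_ifs <;> omega
    · have h1 : (C ∩ E i).card = 1 := Finset.card_eq_one.2 ⟨c, by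
        ext x
        rw [Finset.mem_inter, Finset.mem_singleton]
        exact ⟨fun h => hi x h.1 h.2, by rintro rfl; exact ⟨hc, hci⟩⟩⟩
      have h2 : ∑ x ∈ C, v x = ∑ x ∈ C, (v - edgeExponent E i) x + ∑ x ∈ C, edgeExponent E i x := by
        rw [← Finset.sum_add_distrib]
        exact Finset.sum_congr rfl fun x _ => (DFunLike.congr_fun heq x).symm
      rw [sum_edgeExponent, h1] at h2
      omega

/-- In a transversal of the least possible size no element can be left out. -/
theorem IsTransversal.exists_private_edge {C : Finset σ} (hC : IsTransversal E C)
    (hmin : ∀ C', IsTransversal E C' → C.card ≤ C'.card) {c : σ} (hc : c ∈ C) :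
    ∃ i, c ∈ E i ∧ ∀ x ∈ C, x ∈ E i → x = c := by
  classical
  by_contra! h
  have : IsTransversal E (C.erase c) := fun i => by
    obtain ⟨x, hx, hxi⟩ := hC i
    by_cases hxc : x = c
    · obtain ⟨y, hy, hyi, hyc⟩ := h i (hxc ▸ hxi)
      exact ⟨y, Finset.mem_erase.2 ⟨hyc, hy⟩, hyi⟩
    · exact ⟨x, Finset.mem_erase.2 ⟨hxc, hx⟩, hxi⟩
  have := hmin _ this
  have := Finset.card_erase_lt_of_mem hc
  omega

/-- The truncated standard exponents whose entries are less than `s` exactly on a given minimum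
transversal `C` are those equal to `s` off `C` whose part on `C` has degree less than `s`. Their number
is the length of `K[x_c : c ∈ C] / (x_c : c ∈ C)^s`. -/
theorem card_standardExponents_of_transversal [Fintype σ] [DecidableEq σ] {C : Finset σ}
    (hC : IsTransversal E C) (hmin : ∀ C', IsTransversal E C' → C.card ≤ C'.card)
    (hC0 : 0 < C.card) (s : ℕ) (B : Finset (σ →₀ ℕ))
    (hB : ∀ v, v ∈ B ↔ (∀ x, v x ≤ s) ∧ v ∉ powExponents E s) :
    (B.filter fun v => Finset.univ.filter (fun x => v x < s) = C).card =
      (C.card + s - 1).choose C.card := by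
  let w : σ →₀ ℕ := Finsupp.equivFunOnFinite.symm fun x => if x ∈ C then 0 else s
  have hw : ∀ x, w x = if x ∈ C then 0 else s := fun x => rfl
  have hcount : (B.filter fun v => Finset.univ.filter (fun x => v x < s) = C).card =
      ((Finset.range s).sigma fun t => C.finsuppAntidiag t).card := by
    symm
    refine Finset.card_bij (fun p _ => w + p.2) ?_ ?_ ?_
    · rintro ⟨t, u⟩ h
      simp only [Finset.mem_sigma, Finset.mem_range, Finset.mem_finsuppAntidiag] at h
      obtain ⟨ht, hu, hsupp⟩ := h
      change ∑ x ∈ C, u x = t at hu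
      have huC : ∀ x ∉ C, u x = 0 := fun x hx =>
        Finsupp.notMem_support_iff.1 fun h => hx (hsupp h)
      have hlt : ∀ x ∈ C, u x < s := fun x hx =>
        lt_of_le_of_lt (Finset.single_le_sum (f := u) (fun _ _ => Nat.zero_le _) hx) (by omega)
      rw [Finset.mem_filter, hB]
      refine ⟨⟨fun x => ?_, fun hmem => ?_⟩, ?_⟩
      · simp only [Finsupp.add_apply, hw]
        split_ifs with hx
        · have := hlt x hx
          omega
        · rw [huC x hx, add_zero]
      · have h1 := le_sum_of_mem_powExponents hC hmem
        rw [Finset.sum_congr rfl (g := fun x => u x) fun x hx => by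
          simp [Finsupp.add_apply, hw, hx]] at h1
        omega
      · ext x
        simp only [Finset.mem_filter, Finset.mem_univ, true_and, Finsupp.add_apply, hw]
        by_cases hx : x ∈ C
        · simpa [hx] using hlt x hx
        · simp [hx]
    · rintro ⟨t, u⟩ h ⟨t', u'⟩ h' heq
      simp only [Finset.mem_sigma, Finset.mem_finsuppAntidiag] at h h'
      have hu : u = u' := add_left_cancel heq
      subst hu
      rw [← h.2.1, ← h'.2.1]
    · intro v hv
      rw [Finset.mem_filter, hB] at hv
      obtain ⟨⟨hvs, hvU⟩, hvC⟩ := hv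
      have hlt : ∀ x, x ∈ C ↔ v x < s := fun x => by simp [← hvC]
      have hwv : w ≤ v := fun x => by
        rw [hw]
        split_ifs with hx
        · exact Nat.zero_le _
        · exact not_lt.1 fun h => hx ((hlt x).2 h)
      refine ⟨⟨∑ x ∈ C, v x, v - w⟩, ?_, add_tsub_cancel_of_le hwv⟩
      simp only [Finset.mem_sigma, Finset.mem_range, Finset.mem_finsuppAntidiag]
      refine ⟨?_, Finset.sum_congr rfl fun x hx => ?_, fun x hx => ?_⟩
      · by_contra! hle
        exact hvU (mem_powExponents_of_private_edges
          (fun c hc => hC.exists_private_edge hmin hc)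
          (fun x hx => not_lt.1 fun h => hx ((hlt x).2 h)) hle)
      · simp [hw, hx]
      · by_contra hxC
        rw [Finsupp.mem_support_iff, Finsupp.tsub_apply, hw, if_neg hxC] at hx
        have := hvs x
        omega
  obtain ⟨m, hm⟩ : ∃ m, C.card = m + 1 := ⟨C.card - 1, by omega⟩
  rw [hcount, Finset.card_sigma, Finset.sum_congr rfl (g := fun t => (t + m).choose m), hm]
  · cases s with
    | zero => simp
    | succ s =>
      rw [Nat.sum_range_add_choose]
      congr 1
      omega
  · intro t _
    rw [Finset.card_finsuppAntidiag_nat_eq_choose, hm, show m + 1 + t - 1 = t + m by omega,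
      Nat.choose_symm_add]

/-- The exponents with a given truncation `v` at `s` form an orthant with vertex `v`, spanned by the
variables whose exponent in `v` equals `s` (written `¬ v x < s`, given `v ≤ s`). -/
theorem card_fiber_truncation [Fintype σ] [DecidableEq σ] {s a : ℕ} {v : σ →₀ ℕ}
    (hv : ∀ x, v x ≤ s) (ha : v.degree ≤ a) (T : Finset (σ →₀ ℕ))
    (hT : ∀ u, u ∈ T ↔ u.degree = a ∧ u.mapRange (min s) (min_eq_right s.zero_le) = v) :
    T.card = ((Finset.univ.filter fun x => ¬ v x < s).finsuppAntidiag (a - v.degree)).card := by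
  have hdeg : ∀ u : σ →₀ ℕ, u.support ⊆ Finset.univ.filter (fun x => ¬ v x < s) →
      (Finset.univ.filter fun x => ¬ v x < s).sum u = u.degree := fun u hu =>
    (Finset.sum_subset hu fun x _ hx => Finsupp.notMem_support_iff.1 hx).symm
  symm
  refine Finset.card_bij (fun u _ => v + u) ?_ ?_ ?_
  · intro u hu
    rw [Finset.mem_finsuppAntidiag] at hu
    rw [hT]
    constructor
    · rw [map_add, ← hdeg u hu.2, hu.1]
      omega
    · ext x
      have := hv x
      rw [Finsupp.mapRange_apply, Finsupp.add_apply]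
      by_cases hx : v x < s
      · rw [Finsupp.notMem_support_iff.1 fun h => (Finset.mem_filter.1 (hu.2 h)).2 hx]
        omega
      · omega
  · exact fun u _ u' _ h => add_left_cancel h
  · intro u hu
    rw [hT] at hu
    obtain ⟨hua, huv⟩ := hu
    have huv' : ∀ x, min s (u x) = v x := fun x => DFunLike.congr_fun huv x
    have hle : v ≤ u := fun x => by
      rw [← huv' x]
      exact min_le_right _ _
    have heq := add_tsub_cancel_of_le hle
    have hsupp : (u - v).support ⊆ Finset.univ.filter (fun x => ¬ v x < s) := by
      intro x hx
      rw [Finsupp.mem_support_iff, Finsupp.tsub_apply] at hx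
      have := huv' x
      simp only [Finset.mem_filter, Finset.mem_univ, true_and]
      omega
    refine ⟨u - v, ?_, heq⟩
    rw [Finset.mem_finsuppAntidiag]
    refine ⟨?_, hsupp⟩
    rw [hdeg _ hsupp]
    have := congrArg Finsupp.degree heq
    rw [map_add] at this
    omega

end

/-! ### Standard monomials and Hilbert functions -/

section

variable {K : Type*} [Field K] {σ ι : Type*} {E : ι → Finset σ}

/-- The monomials outside a monomial ideal form a basis of the quotient. -/
theorem finrank_map_restrictSupport {J : Ideal (MvPolynomial σ K)} {U : Set (σ →₀ ℕ)}
    (hJ : ∀ f, f ∈ J ↔ ∀ v ∈ f.support, v ∈ U) (T : Set (σ →₀ ℕ)) (hT : (T \ U).Finite) :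
    Module.Finite K ((MvPolynomial.restrictSupport K T).map (Ideal.Quotient.mkₐ K J).toLinearMap) ∧
    Module.finrank K
      ((MvPolynomial.restrictSupport K T).map (Ideal.Quotient.mkₐ K J).toLinearMap) =
        (T \ U).ncard := by
  have hmap : (MvPolynomial.restrictSupport K T).map (Ideal.Quotient.mkₐ K J).toLinearMap =
      (MvPolynomial.restrictSupport K (T \ U)).map (Ideal.Quotient.mkₐ K J).toLinearMap := by
    apply le_antisymm
    · rw [MvPolynomial.restrictSupport_eq_span, Submodule.map_span, Submodule.span_le]
      rintro _ ⟨_, ⟨v, hv, rfl⟩, rfl⟩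
      by_cases hvU : v ∈ U
      · have : MvPolynomial.monomial v (1 : K) ∈ J := by
          rw [hJ]
          intro w hw
          have := MvPolynomial.support_monomial_subset hw
          rw [Finset.mem_singleton] at this
          rwa [this]
        have h0 : (Ideal.Quotient.mkₐ K J).toLinearMap (MvPolynomial.monomial v (1 : K)) = 0 :=
          Ideal.Quotient.eq_zero_iff_mem.2 this
        simp only [SetLike.mem_coe]
        rw [h0]
        exact Submodule.zero_mem _
      · exact Submodule.mem_map_of_mem
          ((MvPolynomial.monomial_mem_restrictSupport K).2 (Or.inl ⟨hv, hvU⟩))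
    · exact Submodule.map_mono (MvPolynomial.restrictSupport_mono K Set.sdiff_subset)
  have hinj : Set.InjOn (Ideal.Quotient.mkₐ K J).toLinearMap
      (MvPolynomial.restrictSupport K (T \ U) : Set (MvPolynomial σ K)) := by
    intro f hf g hg hfg
    have h1 : f - g ∈ J := Ideal.Quotient.eq.1 hfg
    have h2 : f - g ∈ MvPolynomial.restrictSupport K (T \ U) := Submodule.sub_mem _ hf hg
    rw [hJ] at h1
    rw [MvPolynomial.mem_restrictSupport_iff] at h2
    rw [← sub_eq_zero, ← MvPolynomial.support_eq_empty, Finset.eq_empty_iff_forall_notMem]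
    exact fun v hv => (h2 hv).2 (h1 v hv)
  have := hT.to_subtype
  have hfin := Module.Finite.of_basis (MvPolynomial.basisRestrictSupport K (T \ U))
  rw [hmap]
  refine ⟨inferInstance, ?_⟩
  rw [← LinearMap.range_domRestrict, LinearMap.finrank_range_of_inj (Set.injOn_iff_injective.1 hinj),
    Module.finrank_eq_nat_card_basis (MvPolynomial.basisRestrictSupport K (T \ U))]
  rfl

end

/-! ### Hilbert expansions -/

/-- `f` eventually agrees with a Hilbert polynomial in dimension `D` whose leading Hilbert coefficient
is `c`. -/
def HasHilbertExpansion (D : ℕ) (c : ℤ) (f : ℕ → ℤ) : Prop :=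
  ∃ e : ℕ → ℤ, (∀ᶠ a : ℕ in Filter.atTop, f a =
    ∑ i ∈ Finset.range D, (-1) ^ i * e i * ((a + (D - 1 - i)).choose (D - 1 - i) : ℤ)) ∧ e 0 = c

namespace HasHilbertExpansion

variable {D : ℕ} {c c' : ℤ} {f g : ℕ → ℤ}

theorem zero (D : ℕ) : HasHilbertExpansion D 0 fun _ => 0 :=
  ⟨fun _ => 0, by simp, rfl⟩

theorem congr (hf : HasHilbertExpansion D c f) (h : f =ᶠ[Filter.atTop] g) :
    HasHilbertExpansion D c g := by
  obtain ⟨e, he, hc⟩ := hf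
  refine ⟨e, ?_, hc⟩
  filter_upwards [he, h] with a h1 h2
  rw [← h2, h1]

theorem add (hf : HasHilbertExpansion D c f) (hg : HasHilbertExpansion D c' g) :
    HasHilbertExpansion D (c + c') fun a => f a + g a := by
  obtain ⟨e, he, hc⟩ := hf
  obtain ⟨e', he', hc'⟩ := hg
  refine ⟨fun i => e i + e' i, ?_, by simp [hc, hc']⟩
  filter_upwards [he, he'] with a h1 h2
  rw [h1, h2, ← Finset.sum_add_distrib]
  exact Finset.sum_congr rfl fun i _ => by ring

theorem neg (hf : HasHilbertExpansion D c f) : HasHilbertExpansion D (-c) fun a => -f a := by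
  obtain ⟨e, he, hc⟩ := hf
  refine ⟨fun i => -e i, ?_, by simp [hc]⟩
  filter_upwards [he] with a h1
  rw [h1, ← Finset.sum_neg_distrib]
  exact Finset.sum_congr rfl fun i _ => by ring

theorem sum {α : Type*} (B : Finset α) {c : α → ℤ} {f : α → ℕ → ℤ}
    (h : ∀ v ∈ B, HasHilbertExpansion D (c v) (f v)) :
    HasHilbertExpansion D (∑ v ∈ B, c v) fun a => ∑ v ∈ B, f v a := by
  classical
  induction B using Finset.induction_on with
  | empty => simpa using zero D
  | insert v B hv ih =>
    simp only [Finset.sum_insert hv]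
    exact (h v (Finset.mem_insert_self _ _)).add
      (ih fun u hu => h u (Finset.mem_insert_of_mem hu))

/-- A polynomial of too small a degree is allowed; its leading Hilbert coefficient is zero. -/
theorem succ (hf : HasHilbertExpansion D c f) : HasHilbertExpansion (D + 1) 0 f := by
  obtain ⟨e, he, -⟩ := hf
  refine ⟨fun i => if i = 0 then 0 else -e (i - 1), ?_, rfl⟩
  filter_upwards [he] with a h1
  rw [h1, Finset.sum_range_succ']
  simp only [Nat.add_eq_zero_iff, one_ne_zero, and_false, if_false, if_true, mul_zero, zero_mul,
    add_zero, Nat.add_sub_cancel]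
  refine Finset.sum_congr rfl fun i _ => ?_
  rw [show D - (i + 1) = D - 1 - i by omega]
  ring

theorem of_lt {D' : ℕ} (hf : HasHilbertExpansion D c f) (h : D < D') :
    HasHilbertExpansion D' 0 f := by
  induction D', h using Nat.le_induction with
  | base => exact hf.succ
  | succ _ _ ih => exact ih.succ

/-- Shifted binomial coefficients have integral Hilbert coefficients, by Pascal's rule. -/
theorem choose_shift (m w : ℕ) :
    HasHilbertExpansion (m + 1) 1 fun a => ((a - w + m).choose m : ℤ) := by
  induction m generalizing w with
  | zero => exact ⟨fun _ => 1, by simp, rfl⟩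
  | succ m ihm =>
    induction w with
    | zero =>
      refine ⟨fun i => if i = 0 then 1 else 0, Filter.Eventually.of_forall fun a => ?_, rfl⟩
      rw [Finset.sum_eq_single 0]
      · simp
      · intro i _ hi
        simp [hi]
      · simp
    | succ w ihw =>
      have h := ihw.add (ihm w).succ.neg
      rw [neg_zero, add_zero] at h
      refine h.congr ?_
      filter_upwards [Filter.eventually_ge_atTop (w + 1)] with a ha
      have h1 : a - w + (m + 1) = (a - w + m) + 1 := by omega
      have h2 : a - (w + 1) + (m + 1) = a - w + m := by omega
      rw [h1, h2, Nat.choose_succ_succ]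
      push_cast
      ring

/-- The Hilbert function of an orthant of dimension `#Z` whose vertex has degree `w`. For `a < w` the
subtraction truncates, which does not matter since only large `a` count. -/
theorem card_finsuppAntidiag {σ : Type*} [DecidableEq σ] (Z : Finset σ) (w : ℕ) (hD : 0 < D)
    (hZ : Z.card ≤ D) :
    HasHilbertExpansion D (if Z.card = D then 1 else 0)
      fun a => ((Z.finsuppAntidiag (a - w)).card : ℤ) := by
  have key : ∀ m, Z.card = m + 1 → (fun a => ((a - w + m).choose m : ℤ)) =
      fun a => ((Z.finsuppAntidiag (a - w)).card : ℤ) := by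
    intro m hm
    funext a
    rw [Finset.card_finsuppAntidiag_nat_eq_choose, hm,
      show m + 1 + (a - w) - 1 = a - w + m by omega, Nat.choose_symm_add]
  rcases Nat.eq_zero_or_pos Z.card with h0 | hpos
  · -- An orthant without free directions is a point, of degree `w`; it does not occur beyond `w`.
    rw [if_neg (by omega)]
    refine (zero D).congr ?_
    filter_upwards [Filter.eventually_gt_atTop w] with a ha
    rw [Finset.card_finsuppAntidiag_nat_eq_choose, h0, Nat.choose_eq_zero_of_lt (by omega)]
    rfl
  · obtain ⟨m, hm⟩ : ∃ m, Z.card = m + 1 := ⟨Z.card - 1, by omega⟩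
    rw [← key m hm]
    split_ifs with h
    · rw [← h, hm]
      exact choose_shift m w
    · exact (choose_shift m w).of_lt (by omega)

end HasHilbertExpansion

/-! ### The Hilbert function of a power of an edge ideal -/

section

variable {K : Type*} [Field K] {ι : Type*} {n : ℕ} {E : ι → Finset (Fin n)}

/-- The Hilbert function of `S/I^s` is the sum of those of the orthants given by truncation at `s`. -/
theorem hilbertFunction_edgeIdeal_pow {s a : ℕ} (B : Finset (Fin n →₀ ℕ))
    (hB : ∀ v, v ∈ B ↔ (∀ x, v x ≤ s) ∧ v ∉ powExponents E s) (ha : n * s ≤ a) :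
    hilbertFunction (edgeIdeal K E ^ s) a = ∑ v ∈ B,
      ((Finset.univ.filter fun x => ¬ v x < s).finsuppAntidiag (a - v.degree)).card := by
  classical
  have hT : ({v : Fin n →₀ ℕ | v.degree = a} \ powExponents E s).Finite :=
    (Finsupp.finite_of_degree_eq a).subset Set.sdiff_subset
  have h1 : hilbertFunction (edgeIdeal K E ^ s) a = hT.toFinset.card := by
    rw [← Set.ncard_eq_toFinset_card _ hT,
      ← (finrank_map_restrictSupport (K := K) (fun f => mem_edgeIdeal_pow_iff) _ hT).2,
      hilbertFunction, MvPolynomial.homogeneousSubmodule_eq_finsupp_supported]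
    rfl
  rw [h1, Finset.card_eq_sum_card_fiberwise
    (f := fun u : Fin n →₀ ℕ => u.mapRange (min s) (min_eq_right s.zero_le)) (t := B)]
  · refine Finset.sum_congr rfl fun v hv => ?_
    rw [hB] at hv
    refine card_fiber_truncation hv.1 ?_ _ fun u => ?_
    · rw [Finsupp.degree_eq_sum]
      calc ∑ x, v x ≤ ∑ _x : Fin n, s := Finset.sum_le_sum fun x _ => hv.1 x
        _ ≤ a := by simpa using ha
    · rw [Finset.mem_filter, Set.Finite.mem_toFinset]
      refine ⟨fun h => ⟨h.1.1, h.2⟩, fun h => ⟨⟨h.1, fun hu => hv.2 ?_⟩, h.2⟩⟩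
      rw [← h.2]
      exact mem_powExponents_iff_truncation.2 hu
  · intro u hu
    rw [Finset.mem_coe, Set.Finite.mem_toFinset] at hu
    rw [Finset.mem_coe, hB]
    exact ⟨fun x => by simp, fun h => hu.2 (mem_powExponents_iff_truncation.1 h)⟩

/-- The exponents of standard monomials, truncated at `s`. -/
theorem exists_standardExponents (E : ι → Finset (Fin n)) (s : ℕ) :
    ∃ B : Finset (Fin n →₀ ℕ), ∀ v, v ∈ B ↔ (∀ x, v x ≤ s) ∧ v ∉ powExponents E s := by
  have hfin : {v : Fin n →₀ ℕ | (∀ x, v x ≤ s) ∧ v ∉ powExponents E s}.Finite := by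
    refine (Set.finite_Iic (Finsupp.equivFunOnFinite.symm fun _ : Fin n => s)).subset ?_
    exact fun v hv x => hv.1 x
  exact ⟨hfin.toFinset, fun v => hfin.mem_toFinset⟩

/-! ### The dimension of an edge ideal -/

section

variable {σ : Type*}

/-- The projection onto the coordinate subspace where the variables in `C` vanish. -/
noncomputable def killVariables (K : Type*) [Field K] [DecidableEq σ] (C : Finset σ) :
    MvPolynomial σ K →ₐ[K] MvPolynomial {x // x ∉ C} K :=
  MvPolynomial.aeval fun x => if h : x ∉ C then MvPolynomial.X ⟨x, h⟩ else 0

theorem killVariables_X [DecidableEq σ] (C : Finset σ) (x : σ) :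
    killVariables K C (MvPolynomial.X x) = if h : x ∉ C then MvPolynomial.X ⟨x, h⟩ else 0 :=
  MvPolynomial.aeval_X _ _

theorem killVariables_surjective [DecidableEq σ] (C : Finset σ) :
    Function.Surjective (killVariables K C) := by
  intro f
  refine ⟨MvPolynomial.rename Subtype.val f, ?_⟩
  have : (killVariables K C).comp (MvPolynomial.rename Subtype.val) = AlgHom.id K _ := by
    apply MvPolynomial.algHom_ext
    intro x
    rw [AlgHom.comp_apply, MvPolynomial.rename_X, killVariables_X, dif_pos x.2]
    rfl
  exact DFunLike.congr_fun this f

theorem ringKrullDim_quotient_span_X_le [Fintype σ] (C : Finset σ) :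
    ringKrullDim (MvPolynomial σ K ⧸ Ideal.span
      ((MvPolynomial.X : σ → MvPolynomial σ K) '' C)) ≤ (Fintype.card σ - C.card : ℕ) := by
  classical
  set P := Ideal.span ((MvPolynomial.X : σ → MvPolynomial σ K) '' C)
  let f : MvPolynomial {x // x ∉ C} K →ₐ[K] MvPolynomial σ K ⧸ P :=
    (Ideal.Quotient.mkₐ K P).comp (MvPolynomial.rename Subtype.val)
  have hf : f.comp (killVariables K C) = Ideal.Quotient.mkₐ K P := by
    apply MvPolynomial.algHom_ext
    intro x
    rw [AlgHom.comp_apply, killVariables_X]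
    by_cases h : x ∈ C
    · rw [dif_neg (not_not.2 h), map_zero, eq_comm]
      exact Ideal.Quotient.eq_zero_iff_mem.2 (Ideal.subset_span ⟨x, h, rfl⟩)
    · simp [f, h]
  have hsurj : Function.Surjective f := fun y => by
    obtain ⟨q, rfl⟩ := Ideal.Quotient.mkₐ_surjective K P y
    exact ⟨killVariables K C q, DFunLike.congr_fun hf q⟩
  refine (ringKrullDim_le_of_surjective f.toRingHom hsurj).trans ?_
  rw [MvPolynomial.ringKrullDim_of_isNoetherianRing, ringKrullDim_eq_zero_of_field, zero_add,
    Nat.card_eq_fintype_card, Fintype.card_subtype_compl, Fintype.card_coe]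

/-- A prime containing an edge ideal contains all variables of some transversal; hence the dimension
is governed by the least size of a transversal. -/
theorem ringKrullDim_quotient_edgeIdeal_pow [Fintype σ] {E : ι → Finset σ} {C : Finset σ}
    (hC : IsTransversal E C) (hmin : ∀ C', IsTransversal E C' → C.card ≤ C'.card) {s : ℕ}
    (hs : 1 ≤ s) :
    ringKrullDim (MvPolynomial σ K ⧸ edgeIdeal K E ^ s) = (Fintype.card σ - C.card : ℕ) := by
  classical
  apply le_antisymm
  · rw [ringKrullDim_quotient]
    refine iSup_le fun l => ?_
    let p := l.head.1.asIdeal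
    have hp : edgeIdeal K E ≤ p := by
      have h : edgeIdeal K E ^ s ≤ p := l.head.2
      exact l.head.1.isPrime.le_of_pow_le h
    let C' : Finset σ := {x | MvPolynomial.X x ∈ p}
    have hC' : IsTransversal E C' := fun i => by
      have h := hp (Ideal.subset_span ⟨i, rfl⟩)
      obtain ⟨x, hx, hxp⟩ := (l.head.1.isPrime.prod_mem_iff).1 h
      exact ⟨x, by simpa [C'] using hxp, hx⟩
    have hle : Ideal.span ((MvPolynomial.X : σ → MvPolynomial σ K) '' C') ≤ p := by
      rw [Ideal.span_le]
      rintro _ ⟨x, hx, rfl⟩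
      simpa [C'] using hx
    let l' : LTSeries (PrimeSpectrum.zeroLocus (R := MvPolynomial σ K)
        (Ideal.span ((MvPolynomial.X : σ → MvPolynomial σ K) '' C'))) :=
      { length := l.length
        toFun := fun i => ⟨(l i).1, hle.trans (l.monotone (Fin.zero_le i))⟩
        step := fun i => l.step i }
    have h1 := ringKrullDim_quotient_span_X_le (K := K) C'
    rw [ringKrullDim_quotient] at h1
    refine (le_trans (Order.LTSeries.length_le_krullDim l') h1).trans ?_
    have := hmin C' hC'
    exact_mod_cast Nat.sub_le_sub_left this _
  · have hker : ∀ f ∈ edgeIdeal K E ^ s, killVariables K C f = 0 := by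
      intro f hf
      have hle : edgeIdeal K E ≤ RingHom.ker (killVariables K C) := by
        rw [edgeIdeal, Ideal.span_le]
        rintro _ ⟨i, rfl⟩
        obtain ⟨c, hc, hci⟩ := hC i
        simp only [SetLike.mem_coe, RingHom.mem_ker, map_prod]
        refine Finset.prod_eq_zero hci ?_
        rw [killVariables_X, dif_neg (not_not.2 hc)]
      exact hle (Ideal.pow_le_self (by omega) hf)
    have h := ringKrullDim_le_of_surjective
      (Ideal.Quotient.lift (edgeIdeal K E ^ s) (killVariables K C).toRingHom hker)
      (Ideal.Quotient.lift_surjective_of_surjective _ hker (killVariables_surjective C))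
    rwa [MvPolynomial.ringKrullDim_of_isNoetherianRing, ringKrullDim_eq_zero_of_field, zero_add,
      Nat.card_eq_fintype_card, Fintype.card_subtype_compl, Fintype.card_coe] at h

end

/-! ### The multiplicity -/

/-- The multiplicity of a power of an edge ideal: every minimum transversal `C` contributes the length
of `K[x_c : c ∈ C] / (x_c : c ∈ C)^s`. -/
theorem hasMultiplicity_edgeIdeal_pow {h s : ℕ} (hh : 0 < h) (hs : 1 ≤ s)
    (𝒞 : Finset (Finset (Fin n))) (hne : 𝒞.Nonempty)
    (h𝒞 : ∀ C, C ∈ 𝒞 ↔ IsTransversal E C ∧ C.card = h)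
    (hmin : ∀ C, IsTransversal E C → h ≤ C.card) :
    HasMultiplicity (edgeIdeal K E ^ s) (𝒞.card * ((h + s - 1).choose h : ℤ)) := by
  classical
  obtain ⟨C₀, hC₀⟩ := hne
  rw [h𝒞] at hC₀
  have hhn : h ≤ n := by
    have := Finset.card_le_univ C₀
    rw [Fintype.card_fin] at this
    omega
  have hdim := ringKrullDim_quotient_edgeIdeal_pow (K := K) hC₀.1
    (fun C hC => hC₀.2 ▸ hmin C hC) hs
  rw [Fintype.card_fin, hC₀.2] at hdim
  obtain ⟨B, hB⟩ := exists_standardExponents E s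
  have hlow : ∀ v ∈ B, h ≤ (Finset.univ.filter fun x => v x < s).card := fun v hv =>
    hmin _ (isTransversal_of_notMem_powExponents ((hB v).1 hv).2)
  have hcount : ((B.filter fun v => (Finset.univ.filter fun x => v x < s).card = h).card : ℤ) =
      𝒞.card * ((h + s - 1).choose h : ℤ) := by
    rw [Finset.card_eq_sum_card_fiberwise (f := fun v => Finset.univ.filter fun x => v x < s)
      (t := 𝒞)]
    · rw [Finset.sum_congr rfl (g := fun _ => (h + s - 1).choose h), Finset.sum_const, smul_eq_mul]
      · push_cast
        rfl
      · intro C hC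
        rw [h𝒞] at hC
        rw [Finset.filter_filter, ← hC.2, ← card_standardExponents_of_transversal hC.1
          (fun C' hC' => hC.2 ▸ hmin C' hC') (by omega) s B hB]
        congr 1
        ext v
        simp only [Finset.mem_filter]
        refine and_congr_right fun _ => ⟨fun h => h.2, fun h => ⟨by rw [h], h⟩⟩
    · intro v hv
      rw [Finset.mem_coe, Finset.mem_filter] at hv
      exact (h𝒞 _).2 ⟨isTransversal_of_notMem_powExponents ((hB v).1 hv.1).2, hv.2⟩
  rcases Nat.eq_zero_or_pos (n - h) with h0 | hpos
  · left
    -- The only transversal is the set of all variables, so no exponent in `B` reaches `s`.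
    have hlt : ∀ v ∈ B, Finset.univ.filter (fun x => v x < s) = Finset.univ := fun v hv =>
      Finset.eq_univ_of_card _ (le_antisymm (Finset.card_le_univ _) (by
        have := hlow v hv
        rw [Fintype.card_fin]
        omega))
    have huniv : Set.univ \ powExponents E s = B := by
      ext v
      simp only [Set.mem_sdiff, Set.mem_univ, true_and, Finset.mem_coe]
      refine ⟨fun hv => ?_, fun hv => ((hB v).1 hv).2⟩
      -- The truncation of `v` reaches `s` nowhere, so it is `v` itself.
      have hmem : v.mapRange (min s) (min_eq_right s.zero_le) ∈ B := (hB _).2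
        ⟨fun x => by simp, fun hv' => hv (mem_powExponents_iff_truncation.1 hv')⟩
      have heq : v.mapRange (min s) (min_eq_right s.zero_le) = v := by
        ext x
        have hx := Finset.mem_univ x
        rw [← hlt _ hmem, Finset.mem_filter, Finsupp.mapRange_apply] at hx
        rw [Finsupp.mapRange_apply]
        omega
      rwa [heq] at hmem
    have hfin : (Set.univ \ powExponents E s).Finite := huniv ▸ B.finite_toSet
    obtain ⟨h1, h2⟩ := finrank_map_restrictSupport (K := K)
      (fun f => mem_edgeIdeal_pow_iff (E := E) (s := s)) _ hfin
    have htop : (MvPolynomial.restrictSupport K Set.univ).map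
        (Ideal.Quotient.mkₐ K (edgeIdeal K E ^ s)).toLinearMap = ⊤ := by
      rw [eq_top_iff]
      intro y _
      obtain ⟨q, rfl⟩ := Ideal.Quotient.mkₐ_surjective K _ y
      exact ⟨q, (MvPolynomial.mem_restrictSupport_iff K).2 (Set.subset_univ _), rfl⟩
    rw [htop] at h1 h2
    refine ⟨by rw [hdim, h0]; rfl, Module.finite_def.2 (Module.Finite.iff_fg.1 h1), ?_⟩
    rw [← finrank_top, h2, huniv, Set.ncard_coe_finset, ← hcount]
    congr 2
    rw [Finset.filter_true_of_mem]
    intro v hv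
    rw [hlt v hv, Finset.card_univ, Fintype.card_fin]
    omega
  · right
    refine ⟨n - h, hpos, hdim, ?_⟩
    have hcompl : ∀ v : Fin n →₀ ℕ, (Finset.univ.filter fun x => ¬ v x < s).card =
        n - (Finset.univ.filter fun x => v x < s).card := fun v => by
      rw [← Finset.compl_filter, Finset.card_compl, Fintype.card_fin]
    have hsum := HasHilbertExpansion.sum B fun v hv =>
      HasHilbertExpansion.card_finsuppAntidiag (D := n - h)
        (Finset.univ.filter fun x => ¬ v x < s) v.degree hpos (by
          rw [hcompl]
          exact Nat.sub_le_sub_left (hlow v hv) n)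
    obtain ⟨e, he, he0⟩ := hsum.congr (g := fun a => (hilbertFunction (edgeIdeal K E ^ s) a : ℤ)) (by
      filter_upwards [Filter.eventually_ge_atTop (n * s)] with a ha
      rw [hilbertFunction_edgeIdeal_pow B hB ha]
      push_cast
      rfl)
    refine ⟨e, he, ?_⟩
    rw [he0, ← hcount, Finset.sum_boole]
    congr 2
    refine Finset.filter_congr fun v hv => ?_
    have := hlow v hv
    have hle := Finset.card_le_univ (Finset.univ.filter fun x => v x < s)
    rw [Fintype.card_fin] at hle
    rw [hcompl]
    omega

end

/-- When `d ≤ n` the indices in a window do not repeat. -/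
theorem cyclePathIdeal_eq_edgeIdeal (K : Type*) [Field K] {n d : ℕ} (hd : d ≤ n) :
    cyclePathIdeal K n d = edgeIdeal K (cycleArc n d) := by
  rw [cyclePathIdeal, edgeIdeal]
  congr 2
  funext i
  have hn : NeZero n := ⟨i.pos.ne'⟩
  have hval : ∀ j, (⟨(i.val + j) % n, Nat.mod_lt _ i.pos⟩ : Fin n) = i + Fin.ofNat n j := fun j =>
    Fin.ext (by simp [Fin.val_add])
  simp only [hval]
  refine Finset.prod_bij' (fun j _ => i + Fin.ofNat n j) (fun x _ => (x - i).val) ?_ ?_ ?_ ?_ ?_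
  · intro j hj
    rw [Finset.mem_range] at hj
    simp [cycleArc, Nat.mod_eq_of_lt (hj.trans_le hd), hj]
  · intro x hx
    simpa [cycleArc] using hx
  · intro j hj
    rw [Finset.mem_range] at hj
    simp [Nat.mod_eq_of_lt (hj.trans_le hd)]
  · intro x _
    simp
  · exact fun j _ => rfl

theorem mainTheorem2 (K : Type*) [Field K] (n k d r s : ℕ) (hn : n = k * d + r)
    (hk : 1 ≤ k) (hr : 1 ≤ r) (hrd : r ≤ d) (hs : 1 ≤ s) :
    HasMultiplicity (cyclePathIdeal K n d ^ s)
      (((d : ℤ) * ((k + d - r).choose k : ℤ) - ((k + d - r).choose (k + 1) : ℤ)) *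
        ((k + s).choose (s - 1) : ℤ)) := by
  subst hn
  have hkd : d ≤ k * d := Nat.le_mul_of_pos_left d hk
  have hmin : ∀ C, IsTransversal (cycleArc (k * d + r) d) C → k + 1 ≤ C.card := by
    intro C hC
    have := le_card_mul_of_isTransversal hC
    by_contra! hlt
    have := Nat.mul_le_mul_right d (show C.card ≤ k by omega)
    omega
  have hne : (cycleTransversals (k * d + r) d (k + 1)).Nonempty := by
    rw [← Finset.card_pos]
    refine Nat.pos_of_mul_pos_left (a := k + 1) ?_
    rw [succ_mul_card_cycleTransversals hk hr hrd]
    exact Nat.mul_pos (by omega) (Nat.choose_pos (by omega))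
  have h := hasMultiplicity_edgeIdeal_pow (K := K) (Nat.succ_pos k) hs
    (cycleTransversals (k * d + r) d (k + 1)) hne (fun C => by simp [cycleTransversals]) hmin
  rwa [← cyclePathIdeal_eq_edgeIdeal K (by omega), card_cycleTransversals hk hr hrd,
    show k + 1 + s - 1 = k + s by omega,
    ← Nat.choose_symm_of_eq_add (show k + s = (s - 1) + (k + 1) by omega)] at h
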